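/- Let $K$ be a compact Hausdorff space which is scattered, i.e. every nonempty subset of $K$ has a relatively isolated point. For a compact Hausdorff space $L$, let $C(L)$ denote the Banach space of real-valued continuous functions on $L$ with the supremum norm. A Banach space $X$ is called weakly pcc if every family of weakly open subsets of $X$ which is point-finite (every point of $X$ belongs to only finitely many members of the family) is countable. Suppose that $C(K)$ is weakly pcc. Then $C(K^n)$ is weakly pcc for every $n\in\mathbb{N}$. In particular, for no $n\in\mathbb{N}$ does $C(K^n)$ contain a complemented copy of $c_0(\omega_1)$; that is, no subspace of $C(K^n)$ that is the range of a bounded linear projection on $C(K^n)$ is linearly homeomorphic to $c_0(\omega_1)$, the Banach space, with the supremum norm, of all $f:\omega_1\to\mathbb{R}$ such that $\{\alpha<\omega_1: |f(\alpha)|\ge\varepsilon\}$ is finite for every $\varepsilon>0$. -/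

import Mathlib

open scoped ZeroAtInfty

/-- A topological space is scattered if every nonempty subset has a relatively isolated point. -/
def ScatteredSpace (K : Type*) [TopologicalSpace K] : Prop :=
  ∀ S : Set K, S.Nonempty → ∃ x ∈ S, ∃ U : Set K, IsOpen U ∧ U ∩ S = {x}

/-- A family of subsets of `X` is point-finite if every point of `X` belongs to only finitely many
members of the family. -/
def PointFiniteFamily {X : Type*} (𝒰 : Set (Set X)) : Prop :=
  ∀ x : X, {U ∈ 𝒰 | x ∈ U}.Finite

/-- A real normed space `X` is weakly pcc if every point-finite family of weakly open subsets
of `X` is countable. -/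
def WeaklyPCC (X : Type*) [NormedAddCommGroup X] [NormedSpace ℝ X] : Prop :=
  ∀ 𝒰 : Set (Set (WeakSpace ℝ X)),
    (∀ U ∈ 𝒰, IsOpen U) → PointFiniteFamily 𝒰 → 𝒰.Countable

/-- The set `ω₁` of all countable ordinals, considered with the discrete topology. -/
def DiscreteOmegaOne : Type := (Ordinal.omega.{0} 1).ToType

instance : TopologicalSpace DiscreteOmegaOne := ⊥

instance : DiscreteTopology DiscreteOmegaOne := ⟨rfl⟩

/-- The Banach space `c₀(ω₁)` of real functions on the discrete set `ω₁` that vanish at infinity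
(for each `ε > 0`, all but finitely many values are below `ε` in absolute value), with the
supremum norm. -/
abbrev CZeroOmegaOne : Type := C₀(DiscreteOmegaOne, ℝ)

/-- `X` contains a complemented copy of `Y`: some subspace of `X` that is the range of a bounded
linear projection of `X` is linearly homeomorphic to `Y`. -/
def ContainsComplementedCopy (X Y : Type*) [NormedAddCommGroup X] [NormedSpace ℝ X]
    [NormedAddCommGroup Y] [NormedSpace ℝ Y] : Prop :=
  ∃ F : Submodule ℝ X, F.ClosedComplemented ∧ Nonempty (F ≃L[ℝ] Y)

universe u

open Set Filter Topology

/-! Functionals on `C(L)`, `L` compact scattered, are atomic, so on bounded sets the weak topology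
is that of pointwise convergence. A nonempty weakly open set then contains the part of some ball cut
out by rational conditions at a finite tuple of distinct points. This turns weak pcc of `C(L)` into
a statement about `L`: every proper family of finite tuples is countable
(`WeaklyPCC.countable_of_isProperTuples`, and `ScatteredSpace.weaklyPCC_of_countable` for the
converse). The tuple condition passes from `K` to `K^n`: sort the tuples by which coordinates
coincide and keep one copy of each coordinate (`IsProperTuples.quotient`). -/

theorem ScatteredSpace.of_injective {X Y : Type*} [TopologicalSpace X] [TopologicalSpace Y]
    (hY : ScatteredSpace Y) {f : X → Y} (hf : Continuous f) (hinj : Function.Injective f) :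
    ScatteredSpace X := by
  intro S hS
  obtain ⟨_, ⟨x, hx, rfl⟩, U, hU, hUS⟩ := hY (f '' S) (hS.image f)
  refine ⟨x, hx, f ⁻¹' U, hU.preimage hf, ?_⟩
  have hxU : f x ∈ U ∩ f '' S := hUS ▸ mem_singleton _
  refine subset_antisymm (fun y hy => ?_) (singleton_subset_iff.2 ⟨hxU.1, hx⟩)
  have hy' : f y ∈ U ∩ f '' S := ⟨hy.1, y, hy.2, rfl⟩
  rw [hUS] at hy'
  exact hinj hy'

theorem ScatteredSpace.prod {X Y : Type*} [TopologicalSpace X] [TopologicalSpace Y]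
    (hX : ScatteredSpace X) (hY : ScatteredSpace Y) : ScatteredSpace (X × Y) := by
  intro S hS
  obtain ⟨x, ⟨⟨x', y'⟩, hxy', rfl⟩, U, hU, hUS⟩ := hX (Prod.fst '' S) (hS.image _)
  obtain ⟨y, hy, V, hV, hVS⟩ := hY {y | (x', y) ∈ S} ⟨y', hxy'⟩
  have hxU : x' ∈ U ∩ Prod.fst '' S := hUS ▸ mem_singleton _
  have hyV : y ∈ V ∩ {y | (x', y) ∈ S} := hVS ▸ mem_singleton _
  refine ⟨(x', y), hy, U ×ˢ V, hU.prod hV, subset_antisymm ?_ ?_⟩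
  · rintro ⟨a, b⟩ ⟨⟨ha, hb⟩, hab⟩
    have ha' : a ∈ U ∩ Prod.fst '' S := ⟨ha, (a, b), hab, rfl⟩
    rw [hUS] at ha'
    obtain rfl : a = x' := ha'
    have hb' : b ∈ V ∩ {y | (a, y) ∈ S} := ⟨hb, hab⟩
    rw [hVS] at hb'
    obtain rfl : b = y := hb'
    rfl
  · exact singleton_subset_iff.2 ⟨⟨hxU.1, hyV.1⟩, hy⟩

theorem ScatteredSpace.fin_pi {X : Type*} [TopologicalSpace X] (hX : ScatteredSpace X) (n : ℕ) :
    ScatteredSpace (Fin n → X) := by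
  induction n with
  | zero =>
    rintro S ⟨x, hx⟩
    exact ⟨x, hx, univ, isOpen_univ, subset_antisymm (fun y _ => Subsingleton.elim y x)
      (singleton_subset_iff.2 ⟨mem_univ _, hx⟩)⟩
  | succ n ih =>
    refine (hX.prod ih).of_injective (f := fun x : Fin (n + 1) → X => (x 0, Fin.tail x))
      (by unfold Fin.tail; fun_prop) fun x y hxy => ?_
    rw [Prod.mk.injEq] at hxy
    rw [← Fin.cons_self_tail x, ← Fin.cons_self_tail y, hxy.1, hxy.2]

/-! ### Atomicity of functionals on `C(L)` -/

section Variation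

variable {L : Type*} [TopologicalSpace L] [CompactSpace L]

/-- The variation of the functional `φ` on the set `U` is at most `ε`. -/
def VariationLE (φ : C(L, ℝ) →L[ℝ] ℝ) (U : Set L) (ε : ℝ) : Prop :=
  ∀ f : C(L, ℝ), ‖f‖ ≤ 1 → tsupport f ⊆ U → |φ f| ≤ ε

/-- On the set `U` the functional `φ` is carried by countably many points. -/
def AtomicOn (φ : C(L, ℝ) →L[ℝ] ℝ) (U : Set L) : Prop :=
  ∀ ε > 0, ∃ F : Set L, F.Finite ∧ VariationLE φ (U \ F) ε

theorem VariationLE.mono {φ : C(L, ℝ) →L[ℝ] ℝ} {U V : Set L} {ε : ℝ} (h : VariationLE φ V ε)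
    (hUV : U ⊆ V) : VariationLE φ U ε :=
  fun f hf hfU => h f hf (hfU.trans hUV)

theorem norm_add_le_one_of_disjoint_tsupport {f g : C(L, ℝ)} (hf : ‖f‖ ≤ 1) (hg : ‖g‖ ≤ 1)
    (h : Disjoint (tsupport f) (tsupport g)) : ‖f + g‖ ≤ 1 := by
  refine (ContinuousMap.norm_le _ zero_le_one).2 fun x => ?_
  by_cases hx : x ∈ tsupport f
  · rw [ContinuousMap.add_apply, image_eq_zero_of_notMem_tsupport (h.notMem_of_mem_left hx),
      add_zero]
    exact (f.norm_coe_le_norm x).trans hf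
  · rw [ContinuousMap.add_apply, image_eq_zero_of_notMem_tsupport hx, zero_add]
    exact (g.norm_coe_le_norm x).trans hg

variable [T2Space L]

theorem VariationLE.union {φ : C(L, ℝ) →L[ℝ] ℝ} {U V : Set L} {ε δ : ℝ} (hU : IsOpen U)
    (hV : IsOpen V) (h : VariationLE φ U ε) (h' : VariationLE φ V δ) :
    VariationLE φ (U ∪ V) (ε + δ) := by
  intro f hf hfUV
  obtain ⟨g, hgs, hg1, hg, -⟩ := exists_continuous_sum_one_of_isOpen_isCompact
    (s := ![U, V]) (t := tsupport f) (by simp [Fin.forall_fin_two, hU, hV])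
    (isClosed_tsupport f).isCompact (by
      intro x hx
      rcases hfUV hx with hx | hx
      · exact mem_iUnion.2 ⟨0, hx⟩
      · exact mem_iUnion.2 ⟨1, hx⟩)
  have hnorm : ∀ i, ‖g i * f‖ ≤ 1 := fun i => by
    refine (norm_mul_le _ _).trans (mul_le_one₀ ?_ (norm_nonneg _) hf)
    refine (ContinuousMap.norm_le _ zero_le_one).2 fun x => ?_
    rw [Real.norm_eq_abs, abs_of_nonneg (hg i x).1]
    exact (hg i x).2
  have hsupp : ∀ i, tsupport (g i * f) ⊆ ![U, V] i := fun i =>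
    (tsupport_mul_subset_left (f := g i) (g := f)).trans (hgs i)
  have hsum : f = g 0 * f + g 1 * f := by
    ext x
    by_cases hx : x ∈ tsupport f
    · have := hg1 hx
      simp only [Fin.sum_univ_two, Pi.add_apply, Pi.one_apply] at this
      simp only [ContinuousMap.add_apply, ContinuousMap.mul_apply]
      rw [← add_mul, this, one_mul]
    · simp [image_eq_zero_of_notMem_tsupport hx]
  rw [hsum, map_add]
  exact (abs_add_le _ _).trans
    (add_le_add (h _ (hnorm 0) (hsupp 0)) (h' _ (hnorm 1) (hsupp 1)))

theorem AtomicOn.union {φ : C(L, ℝ) →L[ℝ] ℝ} {U V : Set L} (hU : IsOpen U) (hV : IsOpen V)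
    (h : AtomicOn φ U) (h' : AtomicOn φ V) : AtomicOn φ (U ∪ V) := by
  intro ε hε
  obtain ⟨F, hF, hFU⟩ := h (ε / 2) (half_pos hε)
  obtain ⟨G, hG, hGV⟩ := h' (ε / 2) (half_pos hε)
  refine ⟨F ∪ G, hF.union hG, ?_⟩
  have := VariationLE.union (hU.sdiff hF.isClosed) (hV.sdiff hG.isClosed) hFU hGV
  rw [add_halves] at this
  refine this.mono ?_
  rintro x ⟨hx | hx, hx'⟩
  · exact .inl ⟨hx, fun h => hx' (.inl h)⟩
  · exact .inr ⟨hx, fun h => hx' (.inr h)⟩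

theorem IsCompact.exists_atomicOn {φ : C(L, ℝ) →L[ℝ] ℝ} {C : Set L} (hC : IsCompact C)
    (h : ∀ x ∈ C, ∃ U, IsOpen U ∧ x ∈ U ∧ AtomicOn φ U) :
    ∃ V, IsOpen V ∧ C ⊆ V ∧ AtomicOn φ V := by
  refine hC.induction_on (p := fun C => ∃ V, IsOpen V ∧ C ⊆ V ∧ AtomicOn φ V) ?_ ?_ ?_ ?_
  · refine ⟨∅, isOpen_empty, subset_rfl, fun ε hε => ⟨∅, finite_empty, fun f _ hf => ?_⟩⟩
    rw [sdiff_empty, subset_empty_iff, tsupport_eq_empty_iff] at hf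
    obtain rfl : f = 0 := DFunLike.coe_injective hf
    simpa using hε.le
  · rintro s t hst ⟨V, hV, htV, h⟩
    exact ⟨V, hV, hst.trans htV, h⟩
  · rintro s t ⟨V, hV, hsV, h⟩ ⟨W, hW, htW, h'⟩
    exact ⟨V ∪ W, hV.union hW, union_subset_union hsV htW, h.union hV hW h'⟩
  · intro x hx
    obtain ⟨U, hU, hxU, h⟩ := h x hx
    exact ⟨U, mem_nhdsWithin_of_mem_nhds (hU.mem_nhds hxU), U, hU, subset_rfl, h⟩

/-- Let `f` nearly attain the supremum of `φ` over the unit ball of functions supported in `O`. Any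
`g` supported in `O` off `tsupport f` can be added to `f` without leaving that ball, so `φ g` is
small; compactness handles `tsupport f`. -/
theorem AtomicOn.of_locally {φ : C(L, ℝ) →L[ℝ] ℝ} {O : Set L} (hO : IsOpen O)
    (h : ∀ x ∈ O, ∃ U, IsOpen U ∧ x ∈ U ∧ AtomicOn φ U) : AtomicOn φ O := by
  intro ε hε
  set A : Set ℝ := φ '' {f : C(L, ℝ) | ‖f‖ ≤ 1 ∧ tsupport f ⊆ O} with hA
  have hbdd : BddAbove A := by
    refine ⟨‖φ‖, ?_⟩
    rintro _ ⟨f, ⟨hf, -⟩, rfl⟩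
    exact (le_abs_self _).trans ((φ.le_opNorm f).trans (mul_le_of_le_one_right (norm_nonneg _) hf))
  have hne : A.Nonempty := by
    refine ⟨φ 0, 0, ⟨by simp, ?_⟩, rfl⟩
    rw [ContinuousMap.coe_zero, tsupport_eq_empty_iff.2 rfl]
    exact empty_subset O
  obtain ⟨_, ⟨f, ⟨hf, hfO⟩, rfl⟩, hfs⟩ := exists_lt_of_lt_csSup hne
    (sub_lt_self (sSup A) (half_pos hε))
  obtain ⟨V, hV, hCV, hVa⟩ := (isClosed_tsupport f).isCompact.exists_atomicOn
    fun x hx => h x (hfO hx)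
  obtain ⟨F, hF, hFV⟩ := hVa (ε / 2) (half_pos hε)
  have key : ∀ g : C(L, ℝ), ‖g‖ ≤ 1 → tsupport g ⊆ O \ tsupport f → φ g ≤ ε / 2 := by
    intro g hg hgO
    have hd : Disjoint (tsupport f) (tsupport g) :=
      disjoint_right.2 fun x hx => (hgO hx).2
    have hmem : φ (f + g) ∈ A := by
      refine ⟨f + g, ⟨norm_add_le_one_of_disjoint_tsupport hf hg hd, ?_⟩, rfl⟩
      exact (tsupport_add f g).trans (union_subset hfO (hgO.trans sdiff_subset))
    have := le_csSup hbdd hmem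
    rw [map_add] at this
    linarith
  have hrest : VariationLE φ (O \ tsupport f) (ε / 2) := by
    intro g hg hgO
    refine abs_le'.2 ⟨key g hg hgO, ?_⟩
    rw [← map_neg]
    refine key (-g) (by rwa [norm_neg]) ?_
    have : tsupport (-g : C(L, ℝ)) = tsupport g := by
      simp only [tsupport, ContinuousMap.coe_neg, Function.support_neg]
    rwa [this]
  refine ⟨F, hF, ?_⟩
  have := hFV.union (hV.sdiff hF.isClosed) (hO.sdiff (isClosed_tsupport f)) hrest
  rw [add_halves] at this
  refine this.mono ?_
  rintro x ⟨hx, hx'⟩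
  by_cases hxf : x ∈ tsupport f
  · exact .inl ⟨hCV hxf, hx'⟩
  · exact .inr ⟨hx, hxf⟩

/-- Every continuous functional on `C(L)` is atomic if `L` is a scattered compact space. -/
theorem ScatteredSpace.atomicOn_univ (hL : ScatteredSpace L) (φ : C(L, ℝ) →L[ℝ] ℝ) :
    AtomicOn φ univ := by
  refine AtomicOn.of_locally isOpen_univ fun x _ => ?_
  by_contra hx
  -- An isolated bad point `x` has a punctured neighbourhood of good points; adding `x` to the
  -- finite sets makes `x` good too.
  obtain ⟨x, hxS, U, hU, hUS⟩ := hL {x | ¬ ∃ U, IsOpen U ∧ x ∈ U ∧ AtomicOn φ U} ⟨x, hx⟩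
  have hxU : x ∈ U := (hUS.symm ▸ mem_singleton x : x ∈ U ∩ _).1
  have hO : AtomicOn φ (U \ {x}) := by
    refine AtomicOn.of_locally (hU.sdiff isClosed_singleton) fun y hy => ?_
    by_contra hy'
    have hyU : y ∈ U ∩ {x | ¬ ∃ U, IsOpen U ∧ x ∈ U ∧ AtomicOn φ U} := ⟨hy.1, hy'⟩
    rw [hUS] at hyU
    exact hy.2 hyU
  refine hxS ⟨U, hU, hxU, fun ε hε => ?_⟩
  obtain ⟨F, hF, h⟩ := hO ε hε
  refine ⟨insert x F, hF.insert x, h.mono fun y hy => ⟨⟨hy.1, fun h => hy.2 (.inl h)⟩,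
    fun h => hy.2 (.inr h)⟩⟩

/-- On bounded sets, a continuous functional on `C(L)`, for `L` scattered and compact, is
controlled by the values at finitely many points. -/
theorem ScatteredSpace.exists_finite_abs_le (hL : ScatteredSpace L) (φ : C(L, ℝ) →L[ℝ] ℝ)
    {R ε : ℝ} (hR : 0 < R) (hε : 0 < ε) :
    ∃ F : Set L, F.Finite ∧ ∃ η > 0, ∀ f : C(L, ℝ), ‖f‖ ≤ R → (∀ x ∈ F, |f x| < η) →
      |φ f| ≤ ε := by
  obtain ⟨F, hF, h⟩ := hL.atomicOn_univ φ (ε / (2 * R)) (by positivity)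
  set η := ε / (2 * (‖φ‖ + 1)) with hη
  have hφ := norm_nonneg φ
  have hη0 : 0 < η := by positivity
  refine ⟨F, hF, η, hη0, fun f hf hfF => ?_⟩
  -- Truncation at height `η`: `u` is uniformly small, while `f - u` is supported where `|f| ≥ η`,
  -- hence away from `F`.
  let u : C(L, ℝ) := ⟨fun x => max (-η) (min η (f x)), by fun_prop⟩
  have hux : ∀ x, u x = max (-η) (min η (f x)) := fun x => rfl
  have hu : ‖u‖ ≤ η := (ContinuousMap.norm_le _ hη0.le).2 fun x => by
    rw [Real.norm_eq_abs, hux]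
    exact abs_le.2 ⟨le_max_left _ _, max_le (by linarith) (min_le_left _ _)⟩
  have hfu : ‖f - u‖ ≤ R := (ContinuousMap.norm_le _ hR.le).2 fun x => by
    have hx := (f.norm_coe_le_norm x).trans hf
    rw [Real.norm_eq_abs, abs_le] at hx
    rw [Real.norm_eq_abs, ContinuousMap.sub_apply, hux, abs_le]
    rcases le_total η (f x) with h1 | h1 <;> rcases le_total (-η) (f x) with h2 | h2 <;>
      simp only [min_eq_left, min_eq_right, max_eq_left, max_eq_right, h1, h2,
        show -η ≤ η by linarith] <;> constructor <;> linarith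
  have hsupp : tsupport (f - u) ⊆ {x | η ≤ |f x|} := by
    refine closure_minimal (fun x hx => ?_)
      (isClosed_le continuous_const (by fun_prop))
    by_contra hx'
    rw [mem_ofPred_eq, not_le, abs_lt] at hx'
    apply hx
    rw [ContinuousMap.coe_sub, Pi.sub_apply, hux, min_eq_right hx'.2.le, max_eq_right hx'.1.le,
      sub_self]
  have hscale : |φ (R⁻¹ • (f - u))| ≤ ε / (2 * R) := by
    refine h _ ?_ ?_
    · rw [norm_smul, norm_inv, Real.norm_eq_abs, abs_of_pos hR]
      exact (inv_mul_le_one₀ hR).2 hfu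
    · refine (closure_mono ?_ : _ ⊆ tsupport (f - u)).trans
        (hsupp.trans fun x hx => ⟨mem_univ x, fun hxF => (hfF x hxF).not_ge hx⟩)
      intro x hx hx'
      exact hx (by simpa using .inr hx')
  rw [map_smul, smul_eq_mul, abs_mul, abs_of_pos (inv_pos.2 hR)] at hscale
  have h1 : |φ (f - u)| ≤ ε / 2 := by
    rw [inv_mul_le_iff₀ hR] at hscale
    refine hscale.trans_eq ?_
    field_simp
  have h2 : |φ u| ≤ ε / 2 := by
    refine (φ.le_opNorm u).trans ((mul_le_mul_of_nonneg_left hu hφ).trans ?_)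
    rw [hη, ← mul_div_assoc, div_le_div_iff₀ (by positivity) two_pos]
    nlinarith
  have h3 : φ f = φ (f - u) + φ u := by rw [← map_add, sub_add_cancel]
  rw [h3]
  exact (abs_add_le _ _).trans (by linarith)

end Variation

/-! ### Weak topology and point-finite families -/

section WeakTopology

variable {X : Type*} [NormedAddCommGroup X] [NormedSpace ℝ X]

theorem continuous_apply_toWeakSpace_symm (φ : X →L[ℝ] ℝ) :
    Continuous fun x : WeakSpace ℝ X => φ ((toWeakSpace ℝ X).symm x) :=
  WeakBilin.eval_continuous (topDualPairing ℝ X).flip φ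

theorem tendsto_toWeakSpace {α : Type*} {l : Filter α} {f : α → X} {x : X}
    (h : ∀ φ : X →L[ℝ] ℝ, Tendsto (fun a => φ (f a)) l (𝓝 (φ x))) :
    Tendsto (fun a => toWeakSpace ℝ X (f a)) l (𝓝 (toWeakSpace ℝ X x)) := by
  have hind : IsInducing fun (x : WeakSpace ℝ X) (φ : X →L[ℝ] ℝ) =>
      φ ((toWeakSpace ℝ X).symm x) := ⟨rfl⟩
  exact hind.tendsto_nhds_iff.2 (tendsto_pi_nhds.2 h)

/-- A point-finite indexed family of nonempty weakly open sets of a weakly pcc space has a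
countable index set. -/
theorem WeaklyPCC.countable_index (hX : WeaklyPCC X) {ι : Type*} (V : ι → Set X)
    (hopen : ∀ i, IsOpen ((toWeakSpace ℝ X).symm ⁻¹' V i)) (hne : ∀ i, (V i).Nonempty)
    (hfin : ∀ x, {i | x ∈ V i}.Finite) : Countable ι := by
  set W : ι → Set (WeakSpace ℝ X) := fun i => (toWeakSpace ℝ X).symm ⁻¹' V i with hW
  have hcount : (range W).Countable := by
    refine hX (range W) (forall_mem_range.2 hopen) fun x => ?_
    refine ((hfin ((toWeakSpace ℝ X).symm x)).image W).subset ?_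
    rintro _ ⟨⟨i, rfl⟩, hi⟩
    exact ⟨i, hi, rfl⟩
  rw [← countable_univ_iff]
  refine Countable.mono (s₂ := ⋃ U ∈ range W, W ⁻¹' {U})
    (fun i _ => mem_biUnion (mem_range_self i) rfl) (hcount.biUnion ?_)
  rintro _ ⟨i, rfl⟩
  obtain ⟨x, hx⟩ := hne i
  refine ((hfin x).subset fun j hj => ?_).countable
  have hx' : toWeakSpace ℝ X x ∈ W i := by simpa [hW] using hx
  rw [← show W j = W i from hj] at hx'
  simpa [hW] using hx'

end WeakTopology

/-! ### Weak pcc in terms of proper families of tuples -/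

section Tuples

/-- A family of tuples of distinct points of `L` is proper if it is locally finite, with
multiplicities, in the space of all tuples of distinct points. -/
structure IsProperTuples {L J ι : Type*} [TopologicalSpace L] (y : ι → J → L) : Prop where
  injective : ∀ i, Function.Injective (y i)
  finite : ∀ C : Set (J → L), IsCompact C → (∀ z ∈ C, Function.Injective z) →
    {i | y i ∈ C}.Finite

variable {L : Type*} [TopologicalSpace L] [CompactSpace L] [T2Space L]

theorem exists_continuousMap_eq_on_tuple {J : Type*} [Finite J] {z : J → L}
    (hz : Function.Injective z) {R : ℝ} (hR : 0 ≤ R) {c : J → ℝ} (hc : ∀ j, |c j| ≤ R) :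
    ∃ f : C(L, ℝ), ‖f‖ ≤ R ∧ ∀ j, f (z j) = c j := by
  let _ : TopologicalSpace J := ⊥
  have : DiscreteTopology J := ⟨rfl⟩
  obtain ⟨f, hf, hfc⟩ := ContinuousMap.exists_extension_forall_mem_of_isClosedEmbedding
    (⟨c, continuous_of_discreteTopology⟩ : C(J, ℝ)) (t := Icc (-R) R)
    (fun j => abs_le.1 (hc j)) ⟨0, by simpa using hR⟩
    (continuous_of_discreteTopology.isClosedEmbedding hz)
  exact ⟨f, (ContinuousMap.norm_le _ hR).2 fun x => abs_le.2 (hf x), fun j => congr_fun hfc j⟩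

/-- Prescribe distinct integers `c j` along each tuple with tolerance `1 / 3`. For fixed `f`, the
closed condition defines a compact set of tuples, all injective since `2 / 3 < 1`; properness gives
point-finiteness. -/
theorem WeaklyPCC.countable_of_isProperTuples (hL : WeaklyPCC C(L, ℝ)) {J ι : Type*} [Finite J]
    {y : ι → J → L} (hy : IsProperTuples y) : Countable ι := by
  obtain ⟨n, ⟨e⟩⟩ := Finite.exists_equiv_fin J
  set c : J → ℝ := fun j => (e j : ℕ) with hc
  have hcdist : ∀ j k, |c j - c k| < 1 → j = k := by
    intro j k h
    have h' : |((e j : ℕ) : ℤ) - ((e k : ℕ) : ℤ)| < 1 := by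
      have : ((|((e j : ℕ) : ℤ) - ((e k : ℕ) : ℤ)| : ℤ) : ℝ) < 1 := by
        push_cast
        exact h
      exact_mod_cast this
    have := Int.abs_lt_one_iff.1 h'
    exact e.injective (Fin.ext (by omega))
  refine hL.countable_index (fun i => {f : C(L, ℝ) | ∀ j, |f (y i j) - c j| < 1 / 3})
    (fun i => ?_) (fun i => ?_) fun f => ?_
  · have : (toWeakSpace ℝ C(L, ℝ)).symm ⁻¹' {f : C(L, ℝ) | ∀ j, |f (y i j) - c j| < 1 / 3} =
        ⋂ j, {f | |(toWeakSpace ℝ C(L, ℝ)).symm f (y i j) - c j| < 1 / 3} := by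
      ext f
      simp
    rw [this]
    refine isOpen_iInter_of_finite fun j => isOpen_lt ?_ continuous_const
    have := continuous_apply_toWeakSpace_symm (ContinuousMap.evalCLM ℝ (y i j) : C(L, ℝ) →L[ℝ] ℝ)
    exact (this.sub continuous_const).abs
  · obtain ⟨f, -, hf⟩ := exists_continuousMap_eq_on_tuple (hy.injective i) (R := n)
      (Nat.cast_nonneg n) (c := c) fun j => by
        rw [hc, Nat.abs_cast]
        exact_mod_cast (e j).2.le
    exact ⟨f, fun j => by simp [hf j]⟩
  · refine (hy.finite {z | ∀ j, |f (z j) - c j| ≤ 1 / 3} ?_ ?_).subset fun i hi j => (hi j).le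
    · refine IsClosed.isCompact ?_
      have : {z : J → L | ∀ j, |f (z j) - c j| ≤ 1 / 3} = ⋂ j, {z | |f (z j) - c j| ≤ 1 / 3} := by
        ext z
        simp
      rw [this]
      exact isClosed_iInter fun j => isClosed_le (by fun_prop) continuous_const
    · intro z hz j k hjk
      have h1 := abs_le.1 (hz j)
      have h2 := abs_le.1 (hz k)
      rw [hjk] at h1
      exact hcdist j k (abs_lt.2 ⟨by linarith, by linarith⟩)

/-- On bounded sets of `C(L)`, for `L` scattered and compact, weakly open sets contain
neighbourhoods for the topology of pointwise convergence. -/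
theorem ScatteredSpace.exists_finite_of_isOpen (hL : ScatteredSpace L)
    {U : Set (WeakSpace ℝ C(L, ℝ))} (hU : IsOpen U) {f : C(L, ℝ)}
    (hf : toWeakSpace ℝ C(L, ℝ) f ∈ U) {R : ℝ} (hR : ‖f‖ < R) :
    ∃ F : Set L, F.Finite ∧ ∃ η > 0, ∀ g : C(L, ℝ), ‖g‖ ≤ R → (∀ x ∈ F, |g x - f x| < η) →
      toWeakSpace ℝ C(L, ℝ) g ∈ U := by
  have hR0 : 0 < R := (norm_nonneg f).trans_lt hR
  let l : Filter C(L, ℝ) := ⨅ p : {F : Set L // F.Finite} × {η : ℝ // 0 < η},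
    𝓟 {g | ‖g‖ ≤ R ∧ ∀ x ∈ p.1.1, |g x - f x| < p.2.1}
  have hl : l.HasBasis (fun _ => True)
      fun p : {F : Set L // F.Finite} × {η : ℝ // 0 < η} =>
        {g : C(L, ℝ) | ‖g‖ ≤ R ∧ ∀ x ∈ p.1.1, |g x - f x| < p.2.1} := by
    have : Nonempty ({F : Set L // F.Finite} × {η : ℝ // 0 < η}) :=
      ⟨⟨∅, finite_empty⟩, 1, one_pos⟩
    refine hasBasis_iInf_principal fun p q =>
      ⟨(⟨p.1.1 ∪ q.1.1, p.1.2.union q.1.2⟩, ⟨min p.2.1 q.2.1, lt_min p.2.2 q.2.2⟩), ?_, ?_⟩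
    · exact fun g hg => ⟨hg.1, fun x hx => (hg.2 x (.inl hx)).trans_le (min_le_left _ _)⟩
    · exact fun g hg => ⟨hg.1, fun x hx => (hg.2 x (.inr hx)).trans_le (min_le_right _ _)⟩
  have htend : Tendsto (fun g => toWeakSpace ℝ C(L, ℝ) g) l (𝓝 (toWeakSpace ℝ C(L, ℝ) f)) := by
    refine tendsto_toWeakSpace fun φ => (hl.tendsto_iff Metric.nhds_basis_closedBall).2
      fun ε hε => ?_
    obtain ⟨F, hF, η, hη, h⟩ := hL.exists_finite_abs_le φ (mul_pos two_pos hR0) hε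
    refine ⟨(⟨F, hF⟩, ⟨η, hη⟩), trivial, fun g hg => ?_⟩
    rw [Metric.mem_closedBall, Real.dist_eq, ← map_sub]
    refine h _ ((norm_sub_le g f).trans ?_) hg.2
    linarith [hg.1]
  obtain ⟨p, -, hp⟩ := hl.mem_iff.1 (htend (hU.mem_nhds hf))
  exact ⟨p.1.1, p.1.2, p.2.1, p.2.2, fun g hg hgF => hp ⟨hg, hgF⟩⟩

theorem ScatteredSpace.exists_tuple_of_isOpen (hL : ScatteredSpace L)
    {U : Set (WeakSpace ℝ C(L, ℝ))} (hU : IsOpen U) (hne : U.Nonempty) :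
    ∃ (p : Σ N : ℕ, (Fin N → ℚ) × ℚ × ℕ) (y : Fin p.1 → L), Function.Injective y ∧
      0 < p.2.2.1 ∧ (∀ j, |(p.2.1 j : ℝ)| ≤ p.2.2.2) ∧
      ∀ g : C(L, ℝ), ‖g‖ ≤ p.2.2.2 → (∀ j, |g (y j) - p.2.1 j| < p.2.2.1) →
        toWeakSpace ℝ C(L, ℝ) g ∈ U := by
  obtain ⟨f, hf⟩ := hne
  obtain ⟨f, rfl⟩ := (toWeakSpace ℝ C(L, ℝ)).surjective f
  obtain ⟨R, hR⟩ := exists_nat_gt ‖f‖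
  obtain ⟨F, hF, η, hη, h⟩ := hL.exists_finite_of_isOpen hU hf hR
  have := hF.to_subtype
  obtain ⟨N, ⟨e⟩⟩ := Finite.exists_equiv_fin F
  -- The first bound leaves room for the rational tolerance `q < η / 2`; the second ensures `|c j| ≤
  -- R`.
  have hδ : 0 < min (η / 2) (R - ‖f‖) := lt_min (half_pos hη) (sub_pos.2 hR)
  choose c hc hc' using fun j : Fin N =>
    exists_rat_btwn (sub_lt_self (f (e.symm j)) hδ |>.trans (lt_add_of_pos_right _ hδ))
  have hcf : ∀ j, |f (e.symm j) - c j| < min (η / 2) (R - ‖f‖) := fun j =>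
    abs_lt.2 ⟨by linarith [hc' j], by linarith [hc j]⟩
  obtain ⟨q, hq, hq'⟩ := exists_rat_btwn (half_pos hη)
  refine ⟨⟨N, c, q, R⟩, fun j => e.symm j, Subtype.val_injective.comp e.symm.injective,
    by exact_mod_cast hq, fun j => ?_, fun g hg hgc => h g hg fun x hx => ?_⟩
  · have h1 := (hcf j).trans_le (min_le_right _ _)
    have h2 : |f (e.symm j)| ≤ ‖f‖ := f.norm_coe_le_norm _
    have h3 := abs_sub_abs_le_abs_sub (c j : ℝ) (f (e.symm j))
    rw [abs_sub_comm] at h3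
    change |(c j : ℝ)| ≤ R
    linarith
  · have h1 := (hcf (e ⟨x, hx⟩)).trans_le (min_le_left _ _)
    have h2 : |g (e.symm (e ⟨x, hx⟩)) - c (e ⟨x, hx⟩)| < q := hgc (e ⟨x, hx⟩)
    rw [Equiv.symm_apply_apply] at h1 h2
    rw [abs_lt] at h1 h2 ⊢
    constructor <;> linarith

/-- There are only countably many types of rational data. Within one type the tuples form a proper
family: a function interpolating `c` at an injective `w` lies in every member whose tuple is close
to `w`, so point-finiteness leaves finitely many. -/
theorem ScatteredSpace.weaklyPCC_of_countable {L : Type u} [TopologicalSpace L] [CompactSpace L]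
    [T2Space L] (hL : ScatteredSpace L)
    (h : ∀ (N : ℕ) (ι : Type u) (y : ι → Fin N → L), IsProperTuples y → Countable ι) :
    WeaklyPCC C(L, ℝ) := by
  intro 𝒰 hopen hfin
  suffices hcount : Countable {U : 𝒰 // U.1.Nonempty} by
    have hrange := (countable_range fun U : {U : 𝒰 // U.1.Nonempty} => U.1.1).insert ∅
    refine hrange.mono fun U hU => ?_
    rcases U.eq_empty_or_nonempty with h0 | h0
    · exact .inl h0
    · exact .inr ⟨⟨⟨U, hU⟩, h0⟩, rfl⟩
  choose p y hy hη hc hU using fun U : {U : 𝒰 // U.1.Nonempty} =>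
    hL.exists_tuple_of_isOpen (hopen U.1 U.1.2) U.2
  rw [← countable_univ_iff, ← preimage_univ (f := p), 
    ← biUnion_of_singleton (univ : Set (Σ N : ℕ, (Fin N → ℚ) × ℚ × ℕ)), preimage_iUnion₂]
  refine countable_univ.biUnion ?_
  rintro ⟨N, c, η, R⟩ -
  have hp : ∀ U : p ⁻¹' {⟨N, c, η, R⟩}, ∃ z : Fin N → L, Function.Injective z ∧ 0 < η ∧
      (∀ j, |(c j : ℝ)| ≤ R) ∧ ∀ g : C(L, ℝ), ‖g‖ ≤ R → (∀ j, |g (z j) - c j| < η) →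
        toWeakSpace ℝ C(L, ℝ) g ∈ U.1.1.1 := by
    rintro ⟨U, hpU⟩
    change p U = _ at hpU
    dsimp only
    have h1 := hy U
    have h2 := hη U
    have h3 := hc U
    have h4 := hU U
    generalize y U = z at h1 h2 h3 h4
    generalize p U = q at z hpU h1 h2 h3 h4
    subst hpU
    exact ⟨z, h1, h2, h3, h4⟩
  choose z hz hη' hc' hzU using hp
  rcases (p ⁻¹' {⟨N, c, η, R⟩}).eq_empty_or_nonempty with h0 | ⟨U₀, hU₀⟩
  · rw [h0]
    exact countable_empty
  replace hη' : (0 : ℝ) < η := by exact_mod_cast hη' ⟨U₀, hU₀⟩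
  replace hc' := hc' ⟨U₀, hU₀⟩
  refine countable_coe_iff.1 (h N _ z ⟨hz, fun C hC hinj => ?_⟩)
  refine hC.induction_on (p := fun C => {i | z i ∈ C}.Finite) (by simp)
    (fun s t hst ht => ht.subset fun i hi => hst hi)
    (fun s t hs ht => (hs.union ht).subset fun i hi => hi) fun w hw => ?_
  obtain ⟨f, hf, hfc⟩ := exists_continuousMap_eq_on_tuple (hinj w hw) (Nat.cast_nonneg R) hc'
  refine ⟨{v | ∀ j, |f (v j) - c j| < η}, mem_nhdsWithin_of_mem_nhds ?_, ?_⟩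
  · refine eventually_all.2 fun j => ?_
    have hcont : Continuous fun v : Fin N → L => |f (v j) - c j| := by fun_prop
    refine hcont.continuousAt.eventually_lt continuousAt_const ?_
    simpa [hfc j] using hη'
  · have hinj' : Function.Injective fun i : p ⁻¹' {⟨N, c, η, R⟩} => i.1.1.1 :=
      Subtype.val_injective.comp (Subtype.val_injective.comp Subtype.val_injective)
    refine ((hfin (toWeakSpace ℝ C(L, ℝ) f)).preimage hinj'.injOn).subset fun i hi => ?_
    exact ⟨i.1.1.2, hzU i f hf hi⟩

/-- Properness passes from tuples in a power of `K` to the tuples of their distinct coordinates,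
provided that the coordinates of all members of the family coincide according to one pattern. -/
theorem IsProperTuples.quotient {K J M ι : Type*} [TopologicalSpace K] {y : ι → J → M → K}
    (hy : IsProperTuples y) (r : Setoid (J × M))
    (hr : ∀ i, Setoid.ker (fun q : J × M => y i q.1 q.2) = r) :
    IsProperTuples fun i : ι => fun a : Quotient r =>
      a.lift (fun q : J × M => y i q.1 q.2) fun _ _ h => by rwa [← hr i] at h := by
  refine ⟨fun i a b => ?_, fun C hC hinj => ?_⟩
  · induction a, b using Quotient.inductionOn₂ with
    | h a b =>
      intro h
      refine Quotient.sound ?_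
      change r a b
      rw [← hr i]
      exact h
  · rcases isEmpty_or_nonempty ι with _ | ⟨⟨i₀⟩⟩
    · exact toFinite _
    -- `π` restores the repeated coordinates. On injective `w`, equal rows of `π w` force
    -- `r`-related entries, hence equal rows of `y i₀`.
    let π : (Quotient r → K) → J → M → K := fun w j m => w ⟦(j, m)⟧
    have hπ : Continuous π := by fun_prop
    refine (hy.finite (π '' C) (hC.image hπ) ?_).subset fun i hi => ⟨_, hi, rfl⟩
    rintro _ ⟨w, hw, rfl⟩ j k hjk
    refine hy.injective i₀ (funext fun m => ?_)
    have : r (j, m) (k, m) := Quotient.exact (hinj w hw (congr_fun hjk m))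
    rw [← hr i₀] at this
    exact this

theorem WeaklyPCC.countable_of_isProperTuples_pi (hL : WeaklyPCC C(L, ℝ)) {J M ι : Type*}
    [Finite J] [Finite M] {y : ι → J → M → L} (hy : IsProperTuples y) : Countable ι := by
  have : Finite (Setoid (J × M)) :=
    Finite.of_injective (fun r : Setoid (J × M) => (r : J × M → J × M → Prop))
      fun r s h => Setoid.ext fun a b => iff_of_eq (congr_fun₂ h a b)
  let P : ι → Setoid (J × M) := fun i => Setoid.ker fun q : J × M => y i q.1 q.2
  rw [← countable_univ_iff]
  refine Countable.mono (s₂ := ⋃ r, P ⁻¹' {r}) (fun i _ => mem_iUnion.2 ⟨P i, rfl⟩)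
    (countable_iUnion fun r => ?_)
  have hr : IsProperTuples fun i : P ⁻¹' {r} => y i :=
    ⟨fun i => hy.injective i, fun C hC hinj =>
      Finite.preimage (f := ((↑) : P ⁻¹' {r} → ι)) Subtype.val_injective.injOn
        (hy.finite C hC hinj)⟩
  exact countable_coe_iff.1 (hL.countable_of_isProperTuples (hr.quotient r fun i => i.2))

end Tuples

/-! ### Complemented copies of `c₀(ω₁)` -/

instance : Uncountable DiscreteOmegaOne := by
  rw [← Cardinal.aleph0_lt_mk_iff]
  have : Cardinal.mk DiscreteOmegaOne = Cardinal.aleph 1 := by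
    rw [DiscreteOmegaOne, Cardinal.mk_toType, Ordinal.card_omega]
  rw [this]
  exact Cardinal.aleph0_lt_aleph_one

theorem CZeroOmegaOne.finite_one_lt (f : CZeroOmegaOne) : {a | 1 < f a}.Finite := by
  have h := (zero_at_infty f).eventually_lt_const (zero_lt_one' ℝ)
  rw [cocompact_eq_cofinite, eventually_cofinite] at h
  exact h.subset fun a ha => not_lt.2 (le_of_lt ha)

/-- The sets where coordinate `a` exceeds `1` are point-finite in `c₀(ω₁)`; their preimages under
the bounded surjection `Q` would form an uncountable such family in `X`. -/
theorem WeaklyPCC.not_containsComplementedCopy {X : Type*} [NormedAddCommGroup X]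
    [NormedSpace ℝ X] (hX : WeaklyPCC X) : ¬ ContainsComplementedCopy X CZeroOmegaOne := by
  rintro ⟨F, ⟨P, hP⟩, ⟨T⟩⟩
  let ev : DiscreteOmegaOne → CZeroOmegaOne →L[ℝ] ℝ := fun a =>
    LinearMap.mkContinuous ⟨⟨fun f => f a, fun _ _ => rfl⟩, fun _ _ => rfl⟩ 1 fun f => by
      rw [one_mul]
      exact f.toBCF.norm_coe_le_norm a
  let Q : X →L[ℝ] CZeroOmegaOne := (T : F →L[ℝ] CZeroOmegaOne).comp P
  have hQ : ∀ g, Q (T.symm g) = g := fun g => by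
    change T (P (T.symm g)) = g
    rw [hP, T.apply_symm_apply]
  have hcount := hX.countable_index (fun a : DiscreteOmegaOne => {x | 1 < Q x a}) (fun a => ?_)
    (fun a => ?_) fun x => (Q x).finite_one_lt
  · exact not_countable hcount
  · exact isOpen_lt continuous_const (continuous_apply_toWeakSpace_symm ((ev a).comp Q))
  · classical
    let g : CZeroOmegaOne := ⟨⟨Pi.single a 2, continuous_of_discreteTopology⟩, by
      rw [cocompact_eq_cofinite]
      refine tendsto_const_nhds.congr' (eventually_cofinite.2 ?_)
      refine (finite_singleton a).subset fun b hb => ?_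
      by_contra hba
      exact hb (Pi.single_eq_of_ne (M := fun _ => ℝ) hba 2).symm⟩
    refine ⟨T.symm g, ?_⟩
    change 1 < Q (T.symm g) a
    rw [hQ]
    change (1 : ℝ) < (Pi.single a 2 : DiscreteOmegaOne → ℝ) a
    rw [Pi.single_eq_same]
    exact one_lt_two

theorem WeaklyPCC.fin_pi {K : Type u} [TopologicalSpace K] [CompactSpace K] [T2Space K]
    (hpcc : WeaklyPCC C(K, ℝ)) (hK : ScatteredSpace K) (n : ℕ) : WeaklyPCC C(Fin n → K, ℝ) :=
  (hK.fin_pi n).weaklyPCC_of_countable fun _ _ _ hy => hpcc.countable_of_isProperTuples_pi hy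

theorem mainTheorem9 {K : Type*} [TopologicalSpace K] [CompactSpace K] [T2Space K]
    (hK : ScatteredSpace K) (hpcc : WeaklyPCC C(K, ℝ)) :
    (∀ n : ℕ, WeaklyPCC C(Fin n → K, ℝ)) ∧
      (∀ n : ℕ, ¬ ContainsComplementedCopy C(Fin n → K, ℝ) CZeroOmegaOne) :=
  ⟨hpcc.fin_pi hK, fun n => (hpcc.fin_pi hK n).not_containsComplementedCopy⟩
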